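/- Let $X$ and $Y$ be real locally convex topological vector spaces with topological duals $X^*$ and $Y^*$, let $A\colon X\to Y$ be a continuous linear mapping, and let $f\colon Y\to(-\infty,\infty]$ be a polyhedral convex function, i.e. its epigraph $\{(y,t)\in Y\times\mathbb R \mid f(y)\le t\}$ is a convex polyhedron in $Y\times\mathbb R$ (a set of the form $\{z \mid g_i(z)\le b_i,\ i=1,\dots,m\}$ with finitely many continuous linear functionals $g_i$ on $Y\times\mathbb R$ and reals $b_i$). Assume that the range of $A$ contains a point of $\operatorname{dom} f:=\{y\in Y\mid f(y)<\infty\}$. Then for every $\bar x\in X$ with $\bar y:=A\bar x\in\operatorname{dom} f$, $$\partial(f\circ A)(\bar x)=A^*\big(\partial f(\bar y)\big):=\{A^*y^*\mid y^*\in\partial f(\bar y)\},$$ where $A^*y^*:=y^*\circ A$ and, for a convex function $h\colon Z\to(-\infty,\infty]$ on a real locally convex topological vector space $Z$ and $\bar z\in Z$ with $h(\bar z)<\infty$, $\partial h(\bar z):=\{z^*\in Z^*\mid \langle z^*,z-\bar z\rangle\le h(z)-h(\bar z)\text{ for all } z\in Z\}$. -/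

import Mathlib

namespace PolyhedralChain

section

variable {X Y : Type*}
  [AddCommGroup X] [Module ℝ X] [TopologicalSpace X]
  [AddCommGroup Y] [Module ℝ Y] [TopologicalSpace Y]

/-- A convex polyhedron: the intersection of finitely many closed half-spaces
`{x | g i x ≤ b i}`, with `g i` in the topological dual and `b i` real. -/
def IsConvexPolyhedron (P : Set X) : Prop :=
  ∃ (m : ℕ) (g : Fin m → StrongDual ℝ X) (b : Fin m → ℝ), P = {x | ∀ i, g i x ≤ b i}

/-- The effective domain of an extended-real-valued function. -/
def effDom (f : X → EReal) : Set X := {x | f x < ⊤}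

/-- The epigraph, as a subset of `X × ℝ`. -/
def epi (f : X → EReal) : Set (X × ℝ) := {p | f p.1 ≤ (p.2 : EReal)}

/-- A polyhedral (convex) function with values in `(-∞, ∞]`: it never takes the value `-∞`, and
its epigraph is a convex polyhedron in `X × ℝ`. Convexity of `f` is convexity of its epigraph,
which is automatic for a convex polyhedron. -/
structure IsPolyhedralFun (f : X → EReal) : Prop where
  ne_bot : ∀ x, f x ≠ ⊥
  epi_polyhedron : IsConvexPolyhedron (epi f)

/-- The subdifferential of `f : X → (-∞, ∞]` at a point `xbar` of its effective domain. -/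
def subdifferential (f : X → EReal) (xbar : X) : Set (StrongDual ℝ X) :=
  {xs | ∀ x : X, ((xs (x - xbar) : ℝ) : EReal) ≤ f x - f xbar}

/-- The adjoint `A* : Y* → X*` of a continuous linear map, `⟨A* ys, x⟩ = ⟨ys, A x⟩`. -/
def adjointMap (A : X →L[ℝ] Y) (ys : StrongDual ℝ Y) : StrongDual ℝ X := ys.comp A

end

end PolyhedralChain

/-!
The inclusion `A* (∂f (A x̄)) ⊆ ∂(f ∘ A)(x̄)` is substitution. For the converse, write `epi f` as
`{z | g i z ≤ b i}` and let `x*` be a subgradient of `f ∘ A` at `x̄`, where `f (A x̄) = α` is finite.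

The inequality `x* (x - x̄) ≤ t - α` holds whenever `(A x, t) ∈ epi f`. Moving slightly from
`(x̄, α)` violates no constraint that is slack at `(A x̄, α)`, so the linear functional
`(d, s) ↦ x* d - s` is nonpositive on the cone cut out by `g i (A d, s) ≤ 0`, `i` active. By Farkas'
lemma (`exists_nonneg_sum_eq_of_forall_nonpos`) it equals `∑ lam i * g i (A d, s)` with `lam i ≥ 0`
supported on the active constraints. Then `y* = ∑ lam i • g i (·, 0)` satisfies `y* ∘ A = x*`, and it
is a subgradient of `f` at `A x̄`, since each `g i` attains its maximum `b i` over `epi f` at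
`(A x̄, α)` when `i` is active. The cone generated by finitely many functionals needs no closure,
so Farkas' lemma holds in any dimension without topological input.
-/

namespace PolyhedralChain

/-- **Farkas' lemma** for finitely many linear functionals on a vector space of any dimension, by
induction on the number of functionals. -/
theorem exists_nonneg_sum_eq_of_forall_nonpos {ι V : Type*} [AddCommGroup V] [Module ℝ V]
    (s : Finset ι) (g : ι → V →ₗ[ℝ] ℝ) (φ : V →ₗ[ℝ] ℝ)
    (h : ∀ v, (∀ i ∈ s, g i v ≤ 0) → φ v ≤ 0) :
    ∃ lam : ι → ℝ, (∀ i, 0 ≤ lam i) ∧ ∀ v, φ v = ∑ i ∈ s, lam i * g i v := by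
  classical
  induction s using Finset.induction_on generalizing g φ with
  | empty =>
    refine ⟨fun _ => 0, fun _ => le_rfl, fun v => ?_⟩
    have h1 := h v (by simp)
    have h2 := h (-v) (by simp)
    rw [map_neg] at h2
    simp only [Finset.sum_empty]
    linarith
  | insert j s hj ih =>
    by_cases hs : ∀ v, (∀ i ∈ s, g i v ≤ 0) → φ v ≤ 0
    · obtain ⟨lam, h0, hlam⟩ := ih g φ hs
      refine ⟨Function.update lam j 0, fun i => ?_, fun v => ?_⟩
      · by_cases hi : i = j
        · simp [hi]
        · simpa [hi] using h0 i
      · rw [Finset.sum_insert hj, hlam v, Function.update_self, zero_mul, zero_add]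
        refine Finset.sum_congr rfl fun i hi => ?_
        rw [Function.update_of_ne (ne_of_mem_of_not_mem hi hj)]
    · push Not at hs
      obtain ⟨w, hw, hφw⟩ := hs
      have hgw : 0 < g j w := by
        by_contra hle
        exact absurd (h w (Finset.forall_mem_insert _ _ _ |>.2 ⟨not_lt.1 hle, hw⟩)) (not_le.2 hφw)
      -- Subtracting multiples of `g j` makes every functional vanish on `w`, which amounts to
      -- projecting along `w` onto `ker (g j)`, where the constraint `j` is void.
      obtain ⟨lam, h0, hlam⟩ := ih (fun i => g i - (g i w / g j w) • g j)
        (φ - (φ w / g j w) • g j) (fun v hv => by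
          have := h (v - (g j v / g j w) • w) (Finset.forall_mem_insert _ _ _ |>.2 ⟨?_, ?_⟩)
          · simp only [map_sub, map_smul, smul_eq_mul, LinearMap.sub_apply,
              LinearMap.smul_apply] at this ⊢
            convert this using 2
            ring
          · simp only [map_sub, map_smul, smul_eq_mul]
            rw [div_mul_cancel₀ _ hgw.ne', sub_self]
          · intro i hi
            have := hv i hi
            simp only [map_sub, map_smul, smul_eq_mul, LinearMap.sub_apply,
              LinearMap.smul_apply] at this ⊢
            convert this using 2
            ring)
      have hsum : ∑ i ∈ s, lam i * g i w ≤ 0 :=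
        Finset.sum_nonpos fun i hi => mul_nonpos_of_nonneg_of_nonpos (h0 i) (hw i hi)
      refine ⟨Function.update lam j ((φ w - ∑ i ∈ s, lam i * g i w) / g j w), fun i => ?_,
        fun v => ?_⟩
      · by_cases hi : i = j
        · subst hi
          rw [Function.update_self]
          exact div_nonneg (by linarith) hgw.le
        · simpa [hi] using h0 i
      · have hrest : ∑ i ∈ s, Function.update lam j
            ((φ w - ∑ i ∈ s, lam i * g i w) / g j w) i * g i v = ∑ i ∈ s, lam i * g i v :=
          Finset.sum_congr rfl fun i hi => by
            rw [Function.update_of_ne (ne_of_mem_of_not_mem hi hj)]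
        rw [Finset.sum_insert hj, hrest, Function.update_self]
        have hv := hlam v
        have hexp : ∑ i ∈ s, lam i * (g i v - g i w / g j w * g j v) =
            ∑ i ∈ s, lam i * g i v - (∑ i ∈ s, lam i * g i w) * (g j v / g j w) := by
          rw [Finset.sum_mul, ← Finset.sum_sub_distrib]
          exact Finset.sum_congr rfl fun i _ => by ring
        simp only [LinearMap.sub_apply, LinearMap.smul_apply, smul_eq_mul] at hv
        rw [hexp] at hv
        linear_combination hv

/-- If a point satisfies finitely many affine inequalities, then so does a short step from it in
any direction that does not increase the active ones. -/
theorem exists_pos_forall_add_mul_le {ι : Type*} [Finite ι] (p q b : ι → ℝ)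
    (hp : ∀ i, p i ≤ b i) (hq : ∀ i, p i = b i → q i ≤ 0) :
    ∃ ε : ℝ, 0 < ε ∧ ∀ i, p i + ε * q i ≤ b i := by
  have hev : ∀ᶠ ε : ℝ in nhdsWithin 0 (Set.Ioi 0), ∀ i, p i + ε * q i ≤ b i := by
    refine Filter.eventually_all.2 fun i => ?_
    rcases (hp i).eq_or_lt with hi | hi
    · filter_upwards [self_mem_nhdsWithin] with ε hε
      have := mul_nonpos_of_nonneg_of_nonpos (le_of_lt hε) (hq i hi)
      linarith
    · have hc : Continuous fun ε : ℝ => p i + ε * q i := by fun_prop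
      refine nhdsWithin_le_nhds ?_
      filter_upwards [(hc.tendsto 0).eventually_lt_const (by simpa using hi)] with ε hε
      exact hε.le
  obtain ⟨ε, hε, hpos⟩ := (hev.and self_mem_nhdsWithin).exists
  exact ⟨ε, hpos, hε⟩

/-- The subgradient inequality, read on the epigraph so that only real numbers are compared. -/
theorem mem_subdifferential_iff {Z : Type*} [AddCommGroup Z] [Module ℝ Z] [TopologicalSpace Z]
    {h : Z → EReal} (hbot : ∀ z, h z ≠ ⊥) {zbar : Z} {α : ℝ} (hα : h zbar = α)
    (zs : StrongDual ℝ Z) :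
    zs ∈ subdifferential h zbar ↔ ∀ z (t : ℝ), h z ≤ t → zs (z - zbar) ≤ t - α := by
  simp only [subdifferential, Set.mem_ofPred_eq, hα]
  constructor
  · intro H z t ht
    have := (H z).trans (EReal.sub_le_sub ht le_rfl)
    exact_mod_cast this
  · intro H z
    by_cases htop : h z = ⊤
    · simp [htop]
    · lift h z to ℝ using ⟨htop, hbot z⟩ with r hr
      exact_mod_cast H z r hr.ge

/-- Subgradients of `f ∘ A` come from subgradients of `f`, for `f` polyhedral. -/
theorem subdifferential_comp_subset {X Y : Type*}
    [AddCommGroup X] [Module ℝ X] [TopologicalSpace X]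
    [AddCommGroup Y] [Module ℝ Y] [TopologicalSpace Y]
    (A : X →L[ℝ] Y) {f : Y → EReal} (hf : IsPolyhedralFun f) {xbar : X}
    (hx : A xbar ∈ effDom f) :
    subdifferential (fun x => f (A x)) xbar ⊆ adjointMap A '' subdifferential f (A xbar) := by
  classical
  intro xs hxs
  obtain ⟨α, hα⟩ : ∃ α : ℝ, f (A xbar) = α :=
    ⟨_, (EReal.coe_toReal (ne_of_lt hx) (hf.ne_bot _)).symm⟩
  rw [mem_subdifferential_iff (fun x => hf.ne_bot (A x)) hα] at hxs
  obtain ⟨m, g, b, hepi⟩ := hf.epi_polyhedron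
  have hmem : ∀ y (t : ℝ), f y ≤ t ↔ ∀ i, g i (y, t) ≤ b i := fun y t =>
    Set.ext_iff.1 hepi (y, t)
  have hbase := (hmem _ _).1 hα.le
  let B : X × ℝ →ₗ[ℝ] Y × ℝ := (A : X →ₗ[ℝ] Y).prodMap LinearMap.id
  let φ : X × ℝ →ₗ[ℝ] ℝ := (xs : X →ₗ[ℝ] ℝ).comp (LinearMap.fst ℝ X ℝ) - LinearMap.snd ℝ X ℝ
  obtain ⟨lam, hlam0, hlam⟩ := exists_nonneg_sum_eq_of_forall_nonpos
    (Finset.univ.filter fun i => g i (A xbar, α) = b i)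
    (fun i => (g i : Y × ℝ →ₗ[ℝ] ℝ).comp B) φ (by
      rintro ⟨d, s⟩ hds
      obtain ⟨ε, hε, hstep⟩ := exists_pos_forall_add_mul_le (fun i => g i (A xbar, α))
        (fun i => g i (A d, s)) b hbase (fun i hi => hds i (by simpa using hi))
      have hle := hxs (xbar + ε • d) (α + ε * s) ((hmem _ _).2 fun i => by
        have hsplit : (A (xbar + ε • d), α + ε * s) = (A xbar, α) + ε • (A d, s) := by simp
        rw [hsplit, map_add, map_smul, smul_eq_mul]
        exact hstep i)
      rw [add_sub_cancel_left, add_sub_cancel_left, map_smul, smul_eq_mul] at hle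
      have := le_of_mul_le_mul_left hle hε
      simpa [φ] using this)
  have hlam' : ∀ d (s : ℝ), xs d - s =
      ∑ i with g i (A xbar, α) = b i, lam i * g i (A d, s) := fun d s => hlam (d, s)
  refine ⟨∑ i with g i (A xbar, α) = b i,
    lam i • (g i).comp (ContinuousLinearMap.inl ℝ Y ℝ), ?_, ?_⟩
  · rw [mem_subdifferential_iff hf.ne_bot hα]
    intro y t hyt
    -- The Farkas identity at `(0, t - α)` supplies the vertical component of the active `g i`.
    have hvert := hlam' 0 (t - α)
    have hsum : ∑ i with g i (A xbar, α) = b i, lam i * g i (y - A xbar, t - α) ≤ 0 := by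
      refine Finset.sum_nonpos fun i hi => mul_nonpos_of_nonneg_of_nonpos (hlam0 i) ?_
      have hsplit : (y - A xbar, t - α) = (y, t) - (A xbar, α) := rfl
      rw [hsplit, map_sub, (Finset.mem_filter.1 hi).2]
      exact sub_nonpos.2 ((hmem _ _).1 hyt i)
    have hadd : ∑ i with g i (A xbar, α) = b i, lam i * g i (y - A xbar, t - α) =
        ∑ i with g i (A xbar, α) = b i, lam i * g i (y - A xbar, 0) +
          ∑ i with g i (A xbar, α) = b i, lam i * g i (0, t - α) := by
      rw [← Finset.sum_add_distrib]
      refine Finset.sum_congr rfl fun i _ => ?_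
      rw [← mul_add, ← map_add, Prod.mk_add_mk, add_zero, zero_add]
    have happ : (∑ i with g i (A xbar, α) = b i,
        lam i • (g i).comp (ContinuousLinearMap.inl ℝ Y ℝ)) (y - A xbar) =
        ∑ i with g i (A xbar, α) = b i, lam i * g i (y - A xbar, 0) := by
      simp only [sum_apply]
      rfl
    rw [map_zero, map_zero] at hvert
    rw [happ]
    linarith
  · ext d
    have hd := hlam' d 0
    rw [sub_zero] at hd
    rw [hd, adjointMap, ContinuousLinearMap.comp_apply, sum_apply]
    rfl

end PolyhedralChain

theorem corollary5p9
    {X Y : Type*}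
    [AddCommGroup X] [Module ℝ X] [TopologicalSpace X]
    [IsTopologicalAddGroup X] [ContinuousSMul ℝ X] [LocallyConvexSpace ℝ X]
    [AddCommGroup Y] [Module ℝ Y] [TopologicalSpace Y]
    [IsTopologicalAddGroup Y] [ContinuousSMul ℝ Y] [LocallyConvexSpace ℝ Y]
    (A : X →L[ℝ] Y) (f : Y → EReal)
    (hf : PolyhedralChain.IsPolyhedralFun f)
    (hA : (Set.range A ∩ PolyhedralChain.effDom f).Nonempty) :
    ∀ xbar : X, A xbar ∈ PolyhedralChain.effDom f →
      PolyhedralChain.subdifferential (fun x => f (A x)) xbar =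
        PolyhedralChain.adjointMap A '' PolyhedralChain.subdifferential f (A xbar) := by
  intro xbar hx
  refine (PolyhedralChain.subdifferential_comp_subset A hf hx).antisymm ?_
  rintro _ ⟨ys, hys, rfl⟩ x
  have := hys (A x)
  rwa [← map_sub] at this
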